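/- Let $\mathrm{SL}(n)^3=\mathrm{SL}(n,\mathbb C)^3$ act on $(\mathbb C^n)^{\otimes 3}$ by $(g_1,g_2,g_3)\cdot v=(g_1\otimes g_2\otimes g_3)v$, let $\|\cdot\|$ be the standard Hermitian norm on $(\mathbb C^n)^{\otimes 3}$, and let $\operatorname{capa}(v)=\inf_{g\in \mathrm{SL}(n)^3}\|g\cdot v\|^2$. For $R\ge 0$ let the geodesic ball $B_R\subseteq \mathrm{SL}(n)^3$ of radius $R$ about the identity be the set of all $g=(U_1e^{A_1},U_2e^{A_2},U_3e^{A_3})\in \mathrm{SL}(n)^3$ with $U_i$ unitary, $A_i$ Hermitian and $\big(\|A_1\|_F^2+\|A_2\|_F^2+\|A_3\|_F^2\big)^{1/2}\le R$. The bit complexity of a rational number is the total number of binary digits of its numerator and denominator in lowest terms. There are absolute constants $C,K_1,K_2,c>0$ such that the following holds for all integers $n\ge 3$ and all real $0<\varepsilon\le \exp(-Cn^2\log n)$. There is a tensor $v=v(\varepsilon)\in(\mathbb C^n)^{\otimes 3}$ with at most $K_1 n$ nonzero entries, all of them rational of bit complexity at most $K_2(\log n+\log(1/\varepsilon))$, with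 $$\tfrac14\le \operatorname{capa}(v)\le 1,\qquad \tfrac12\le\|v\|\le 1,$$ and there is a radius $R\ge c\,2^{n/3}\log(1/\varepsilon)$ such that $$\inf_{g\in B_R}\|g\cdot v\|^2\ \ge\ \operatorname{capa}(v)+\varepsilon .$$ -/

import Mathlib

open scoped Kronecker

noncomputable section

namespace TensorScaling

/-- The space of 3-tensors `(ℂⁿ)^{⊗3}` in coordinates `v (i, j, k)`, with the standard Hermitian
inner product (so `‖v‖² = ∑ |v (i, j, k)|²`). -/
abbrev Tensor (n : ℕ) : Type := EuclideanSpace ℂ (Fin n × Fin n × Fin n)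

/-- The group `SL(n, ℂ)³`. -/
abbrev G (n : ℕ) : Type :=
  Matrix.SpecialLinearGroup (Fin n) ℂ × Matrix.SpecialLinearGroup (Fin n) ℂ ×
    Matrix.SpecialLinearGroup (Fin n) ℂ

/-- The tensor scaling action `(g₁, g₂, g₃) · v = (g₁ ⊗ g₂ ⊗ g₃) v`. -/
def act {n : ℕ} (g : G n) (v : Tensor n) : Tensor n :=
  WithLp.toLp 2 (Matrix.mulVec (g.1.val ⊗ₖ (g.2.1.val ⊗ₖ g.2.2.val)) v.ofLp)

/-- The capacity `inf_{g ∈ SL(n)³} ‖g · v‖²`. -/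
def capa {n : ℕ} (v : Tensor n) : ℝ := ⨅ g : G n, ‖act g v‖ ^ 2

/-- The squared Frobenius norm of a complex matrix. -/
def frobeniusSq {n : ℕ} (A : Matrix (Fin n) (Fin n) ℂ) : ℝ := ∑ i, ∑ j, ‖A i j‖ ^ 2

/-- The geodesic ball of radius `R` about the identity in `SL(n)³`: the triples of the form
`U exp(A)` in `SL(n)³`, where `U` is a triple of unitary matrices and `A` is a triple of Hermitian
matrices whose Frobenius norm (as a block diagonal matrix) is at most `R`. -/
def geodesicBall (n : ℕ) (R : ℝ) : Set (G n) :=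
  {g | ∃ U₁ U₂ U₃ A₁ A₂ A₃ : Matrix (Fin n) (Fin n) ℂ,
    U₁ ∈ Matrix.unitaryGroup (Fin n) ℂ ∧ U₂ ∈ Matrix.unitaryGroup (Fin n) ℂ ∧
    U₃ ∈ Matrix.unitaryGroup (Fin n) ℂ ∧
    A₁.IsHermitian ∧ A₂.IsHermitian ∧ A₃.IsHermitian ∧
    Real.sqrt (frobeniusSq A₁ + frobeniusSq A₂ + frobeniusSq A₃) ≤ R ∧
    g.1.val = U₁ * NormedSpace.exp A₁ ∧
    g.2.1.val = U₂ * NormedSpace.exp A₂ ∧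
    g.2.2.val = U₃ * NormedSpace.exp A₃}

/-- The number of nonzero entries of a tensor. -/
def numNonzero {n : ℕ} (v : Tensor n) : ℕ := {x | v x ≠ 0}.ncard

/-- The bit complexity of a rational number: the total number of binary digits of the numerator
and the denominator in lowest terms. -/
def bitComplexity (q : ℚ) : ℕ := q.num.natAbs.size + q.den.size

end TensorScaling

end

/-!
The tensor is, up to a scalar `1 / N`, the indicator function of a set of triples in `(Fin n)³`:
the edges of a regular tripartite hypergraph and one additional hyperedge `w` (a `Design`).

*Reduction to the torus.* The hyperedges form an antichain for suitable orderings of the three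
index sets. By Gram-Schmidt, `g = Uᴴ T` with `U` unitary and `T` triangular for these orderings, and
the antichain property makes the entries of `T · v` on the support equal to those of `v` times
products of diagonal entries of `T`. Hence `‖g · v‖²` is at least `N⁻² ∑ exp (2 ⟨X, e⟩)`, the sum
being over all hyperedges `e`, where `X` consists of the logarithms of the `|T i i|`
(`Design.exists_torus_le`). If `g` lies in the ball of radius `R`, the entries of `X` are at most
`R`, and at least `-(n - 1) R` as they sum to zero.

*Capacity.* By regularity `∑ ⟨X, e⟩ = 0` over the edges, so the sum over the edges is at least their
number. The additional term can be made arbitrarily small by the potentials of the design, which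
vanish on the edges and are negative on `w`. Thus the capacity is the number of edges divided by
`N²` (`Design.capa_tensor`), and it is not attained.

*Large radius.* If `‖g · v‖²` exceeds the capacity by less than `ε`, then all `⟨X, e⟩` for edges `e`
are bounded, whereas `⟨X, w⟩ ≤ -log (1 / ε) / 2 + O(log n)` (`Design.log_le_of_norm_act_lt`). It
remains to choose `w` exponentially close to the span of the edges (`Design.IsNearSpan`). In the
chain design, the permutations of `(k, k, k + 1)` are edges for `k < m = n - 4`; adding these up
shows that the value `S k` of a functional on `(k, k, k)` satisfies `S (k + 1) = -2 S k` modulo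
edges, so that `|S 0| ≤ O(1) + 2⁻ᵐ |S m|`. Twelve closing edges make the hypergraph regular, and `w`
is congruent to `-(0, 0, 0)` modulo edges but, unlike `(0, 0, 0)`, incomparable to all edges
(`chainDesign`). The few `n ≤ 7` need no exponential growth and are covered by `diagonalDesign`.
-/

noncomputable section

namespace TensorScaling

/-! ### Triangularization and operator norms -/

theorem norm_exp_le_exp_norm {𝔸 : Type*} [NormedRing 𝔸] [NormOneClass 𝔸] [NormedAlgebra ℂ 𝔸]
    [CompleteSpace 𝔸] (x : 𝔸) : ‖NormedSpace.exp x‖ ≤ Real.exp ‖x‖ := by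
  have hs : HasSum (fun k : ℕ => ((k.factorial : ℝ)⁻¹) • ‖x‖ ^ k) (Real.exp ‖x‖) := by
    rw [Real.exp_eq_exp_ℝ]
    exact NormedSpace.exp_series_hasSum_exp' (𝕂 := ℝ) ‖x‖
  rw [NormedSpace.exp_eq_tsum ℂ]
  refine tsum_of_norm_bounded hs fun k => ?_
  rw [norm_smul, smul_eq_mul, norm_inv, Complex.norm_natCast]
  gcongr
  exact norm_pow_le x k

section OperatorNorm

open scoped Matrix.Norms.L2Operator

theorem norm_entry_le_opNorm {n : ℕ} (A : Matrix (Fin n) (Fin n) ℂ) (i j : Fin n) :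
    ‖A i j‖ ≤ ‖A‖ := by
  have h := Matrix.l2_opNorm_mulVec A (EuclideanSpace.single j (1 : ℂ))
  have h2 := PiLp.norm_apply_le (WithLp.toLp 2 (A.mulVec (EuclideanSpace.single j (1 : ℂ)).ofLp)) i
  simp at h h2
  exact h2.trans h

theorem opNorm_le_sqrt_frobeniusSq {n : ℕ} (A : Matrix (Fin n) (Fin n) ℂ) :
    ‖A‖ ≤ √(frobeniusSq A) := by
  rw [Matrix.l2_opNorm_def]
  refine ContinuousLinearMap.opNorm_le_bound _ (Real.sqrt_nonneg _) fun x => ?_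
  rw [EuclideanSpace.norm_eq x, ← Real.sqrt_mul (by unfold frobeniusSq; positivity),
    EuclideanSpace.norm_eq]
  apply Real.sqrt_le_sqrt
  rw [frobeniusSq, Finset.sum_mul]
  refine Finset.sum_le_sum fun i _ => ?_
  refine le_trans ?_ (Finset.sum_mul_sq_le_sq_mul_sq Finset.univ (fun j => ‖A i j‖) fun j => ‖x j‖)
  gcongr
  refine le_trans (b := ‖∑ j, A i j * x j‖) (le_of_eq rfl) ?_
  exact (norm_sum_le _ _).trans (le_of_eq (by simp))

theorem norm_mulVec_le_of_mem_unitaryGroup {ι : Type*} [Fintype ι] [DecidableEq ι]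
    {U : Matrix ι ι ℂ} (hU : U ∈ Matrix.unitaryGroup ι ℂ) (w : ι → ℂ) :
    ‖WithLp.toLp 2 (U.mulVec w)‖ ≤ ‖WithLp.toLp 2 w‖ := by
  rcases isEmpty_or_nonempty ι with hι | hι
  · exact le_of_eq (congrArg _ (Subsingleton.elim _ _))
  · have h := Matrix.l2_opNorm_mulVec U (WithLp.toLp 2 w)
    rwa [CStarRing.norm_of_mem_unitary hU, one_mul] at h

/-- The entries of `V U exp A`, for `V`, `U` unitary, are bounded by the exponential of the
Frobenius norm of `A`. -/
theorem norm_entry_unitary_mul_exp_le {n : ℕ} {V U A : Matrix (Fin n) (Fin n) ℂ}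
    (hV : V ∈ Matrix.unitaryGroup (Fin n) ℂ) (hU : U ∈ Matrix.unitaryGroup (Fin n) ℂ) {R : ℝ}
    (hA : √(frobeniusSq A) ≤ R) (i j : Fin n) :
    ‖(V * (U * NormedSpace.exp A)) i j‖ ≤ Real.exp R := by
  have : Nonempty (Fin n) := ⟨i⟩
  rw [← mul_assoc]
  refine (norm_entry_le_opNorm _ i j).trans ((norm_mul_le _ _).trans ?_)
  have h1 : ‖V * U‖ = 1 := CStarRing.norm_of_mem_unitary (mul_mem hV hU)
  rw [h1, one_mul]
  exact (norm_exp_le_exp_norm A).trans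
    (Real.exp_le_exp.mpr ((opNorm_le_sqrt_frobeniusSq A).trans hA))

end OperatorNorm

/-- QR decomposition of a square matrix, with respect to the ordering of the indices by an
arbitrary injective function `α`. -/
theorem exists_unitary_mul_triangular {ι : Type*} [Fintype ι] [DecidableEq ι] {α : ι → ℤ}
    (hα : Function.Injective α) (g : Matrix ι ι ℂ) :
    ∃ U ∈ Matrix.unitaryGroup ι ℂ, ∀ i j, α j < α i → (U * g) i j = 0 := by
  let _ : LinearOrder ι := LinearOrder.lift' α hα
  let _ : LocallyFiniteOrderBot ι :=
    LocallyFiniteOrderBot.ofIic ι (fun a => Finset.univ.filter (· ≤ a)) (by simp)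
  let f : ι → EuclideanSpace ℂ ι := fun j => WithLp.toLp 2 fun i => g i j
  let b := InnerProductSpace.gramSchmidtOrthonormalBasis (𝕜 := ℂ) (E := EuclideanSpace ℂ ι)
    (by simp) f
  refine ⟨Matrix.of fun i k => star (b i k), ?_, fun i j hij => ?_⟩
  · rw [Matrix.mem_unitaryGroup_iff]
    ext i j
    have h := orthonormal_iff_ite.mp b.orthonormal i j
    rw [EuclideanSpace.inner_eq_star_dotProduct] at h
    rw [Matrix.one_apply, ← h, Matrix.mul_apply]
    simp [dotProduct, mul_comm, Matrix.star_apply]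
  · have h := InnerProductSpace.gramSchmidtOrthonormalBasis_inv_triangular
      (𝕜 := ℂ) (E := EuclideanSpace ℂ ι) (by simp) f (show j < i from hij)
    rw [EuclideanSpace.inner_eq_star_dotProduct] at h
    rw [← h, Matrix.mul_apply]
    simp [dotProduct, mul_comm, f, b]

theorem det_eq_prod_diag_of_triangular {ι : Type*} [Fintype ι] [DecidableEq ι] {α : ι → ℤ}
    (hα : Function.Injective α) {T : Matrix ι ι ℂ} (hT : ∀ i j, α j < α i → T i j = 0) :
    T.det = ∏ i, T i i := by
  let _ : LinearOrder ι := LinearOrder.lift' α hα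
  exact Matrix.det_of_isUpperTriangular fun i j hij => hT i j hij

/-- The numbers `log |T i i|`, for a triangular `T = U g` with `U` unitary and `det g = 1`, sum to
zero, and the diagonal entries do not vanish. -/
theorem sum_log_norm_diag_eq_zero {n : ℕ} {α : Fin n → ℤ} (hα : Function.Injective α)
    {U g : Matrix (Fin n) (Fin n) ℂ} (hU : U ∈ Matrix.unitaryGroup (Fin n) ℂ) (hg : g.det = 1)
    (hT : ∀ i j, α j < α i → (U * g) i j = 0) :
    (∀ i, (U * g) i i ≠ 0) ∧ ∑ i, Real.log ‖(U * g) i i‖ = 0 := by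
  have h1 : ‖∏ i, (U * g) i i‖ = 1 := by
    rw [← det_eq_prod_diag_of_triangular hα hT, Matrix.det_mul, hg, mul_one]
    exact CStarRing.norm_of_mem_unitary (Matrix.det_of_mem_unitary hU)
  have h0 : ∀ i, (U * g) i i ≠ 0 := fun i hi => by
    have h2 : ∏ i, (U * g) i i = 0 := Finset.prod_eq_zero (Finset.mem_univ i) hi
    rw [h2, norm_zero] at h1
    exact zero_ne_one h1
  refine ⟨h0, ?_⟩
  rw [← Real.log_prod (fun i _ => norm_ne_zero_iff.mpr (h0 i)), ← norm_prod, h1, Real.log_one]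

/-! ### Designs and the capacity of their tensors -/

/-- The value at the weight `w = (i, j, k)` of the linear functional `(x, y, z)` on `(ℝⁿ)³`. -/
def pairing {n : ℕ} (x y z : Fin n → ℝ) (w : Fin n × Fin n × Fin n) : ℝ :=
  x w.1 + y w.2.1 + z w.2.2

/-- A `D`-regular tripartite hypergraph on three copies of `Fin n`, with one additional hyperedge,
and potentials `α`, `β`, `γ` that sum to zero on the edges of the hypergraph, to a negative number
on the additional hyperedge, and for which all these hyperedges form an antichain. -/
structure Design (n D : ℕ) where
  /-- The index type of the edges. -/
  E : Type
  [fintypeE : Fintype E]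
  /-- The edges of the regular hypergraph. -/
  edge : E → Fin n × Fin n × Fin n
  /-- The additional hyperedge. -/
  extra : Fin n × Fin n × Fin n
  /-- The potential on the first part. -/
  α : Fin n → ℤ
  /-- The potential on the second part. -/
  β : Fin n → ℤ
  /-- The potential on the third part. -/
  γ : Fin n → ℤ
  α_injective : Function.Injective α
  β_injective : Function.Injective β
  γ_injective : Function.Injective γ
  edge_injective : Function.Injective edge
  edge_sum : ∀ e, α (edge e).1 + β (edge e).2.1 + γ (edge e).2.2 = 0
  extra_sum : α extra.1 + β extra.2.1 + γ extra.2.2 < 0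
  not_extra_le : ∀ e, ¬ (α extra.1 ≤ α (edge e).1 ∧ β extra.2.1 ≤ β (edge e).2.1 ∧
    γ extra.2.2 ≤ γ (edge e).2.2)
  regular₁ : ∀ x : Fin n → ℝ, ∑ e, x (edge e).1 = D * ∑ i, x i
  regular₂ : ∀ x : Fin n → ℝ, ∑ e, x (edge e).2.1 = D * ∑ i, x i
  regular₃ : ∀ x : Fin n → ℝ, ∑ e, x (edge e).2.2 = D * ∑ i, x i

attribute [instance] Design.fintypeE

namespace Design

variable {n D : ℕ} (S : Design n D)

/-- The support of the tensor of a design: the edges together with the additional hyperedge. -/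
def supp : Option S.E → Fin n × Fin n × Fin n
  | none => S.extra
  | some e => S.edge e

/-- Two hyperedges of a design that are comparable, in the product order given by the potentials,
are equal. -/
theorem supp_antichain (o o' : Option S.E) (h₁ : S.α (S.supp o).1 ≤ S.α (S.supp o').1)
    (h₂ : S.β (S.supp o).2.1 ≤ S.β (S.supp o').2.1)
    (h₃ : S.γ (S.supp o).2.2 ≤ S.γ (S.supp o').2.2) : o = o' := by
  have hs := S.extra_sum
  rcases o with _ | e <;> rcases o' with _ | e'
  · rfl
  · exact absurd ⟨h₁, h₂, h₃⟩ (S.not_extra_le e')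
  · have h := S.edge_sum e
    simp only [supp] at h₁ h₂ h₃
    omega
  · have h := S.edge_sum e
    have h' := S.edge_sum e'
    simp only [supp] at h₁ h₂ h₃
    refine congrArg some (S.edge_injective (Prod.ext (S.α_injective ?_)
      (Prod.ext (S.β_injective ?_) (S.γ_injective ?_)))) <;> omega

theorem supp_injective : Function.Injective S.supp := fun o o' h =>
  S.supp_antichain o o' (by rw [h]) (by rw [h]) (by rw [h])

/-- The tensor of a design: the indicator function of the support, divided by `N`. -/
def tensor (N : ℕ) : Tensor n :=
  open scoped Classical in
  WithLp.toLp 2 fun w => if w ∈ Set.range S.supp then ((N : ℂ))⁻¹ else 0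

theorem tensor_supp (N : ℕ) (o : Option S.E) : S.tensor N (S.supp o) = ((N : ℂ))⁻¹ := by
  simp [tensor]

theorem tensor_eq_zero (N : ℕ) {w : Fin n × Fin n × Fin n} (hw : w ∉ Set.range S.supp) :
    S.tensor N w = 0 := by
  simp only [tensor, if_neg hw]

theorem sum_eq_sum_supp (F : Fin n × Fin n × Fin n → ℝ) (hF : ∀ w ∉ Set.range S.supp, F w = 0) :
    ∑ w, F w = ∑ o, F (S.supp o) :=
  (Fintype.sum_of_injective S.supp S.supp_injective _ _ hF fun _ => rfl).symm

theorem sum_supp_le_sum (F : Fin n × Fin n × Fin n → ℝ) (hF : ∀ w, 0 ≤ F w) :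
    ∑ o, F (S.supp o) ≤ ∑ w, F w := by
  classical
  rw [← Finset.sum_image (f := F) fun a _ b _ h => S.supp_injective h]
  exact Finset.sum_le_sum_of_subset_of_nonneg (Finset.subset_univ _) fun w _ _ => hF w

theorem card_edges : (Fintype.card S.E : ℝ) = D * n := by
  have h := S.regular₁ fun _ => 1
  simpa using h

theorem sum_pairing_edge (x y z : Fin n → ℝ) :
    ∑ e, pairing x y z (S.edge e) = D * (∑ i, x i + ∑ i, y i + ∑ i, z i) := by
  simp only [pairing, Finset.sum_add_distrib, S.regular₁, S.regular₂, S.regular₃]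
  ring

theorem norm_tensor_sq (N : ℕ) : ‖S.tensor N‖ ^ 2 = (D * n + 1) * ((N : ℝ)⁻¹) ^ 2 := by
  rw [EuclideanSpace.norm_sq_eq,
    S.sum_eq_sum_supp _ fun w hw => by rw [S.tensor_eq_zero N hw]; simp]
  rw [Fintype.sum_option]
  simp only [tensor_supp, norm_inv, Complex.norm_natCast, Finset.sum_const, Finset.card_univ,
    nsmul_eq_mul, S.card_edges]
  ring

theorem numNonzero_tensor_le (N : ℕ) : (numNonzero (S.tensor N) : ℝ) ≤ D * n + 1 := by
  have h1 : {w | S.tensor N w ≠ 0} ⊆ Set.range S.supp := fun w hw => by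
    by_contra h
    exact hw (S.tensor_eq_zero N h)
  have h2 : numNonzero (S.tensor N) ≤ Fintype.card (Option S.E) := by
    refine (Set.ncard_le_ncard h1 (Set.finite_range _)).trans ?_
    rw [← Set.image_univ]
    refine (Set.ncard_image_le).trans ?_
    simp [Set.ncard_univ]
  rw [Fintype.card_option] at h2
  rw [← S.card_edges]
  exact_mod_cast h2

/-- The action of triangular matrices multiplies the entries on the support by the diagonal
entries, because the support is an antichain. -/
theorem triangular_mulVec_tensor (N : ℕ) {T₁ T₂ T₃ : Matrix (Fin n) (Fin n) ℂ}
    (h₁ : ∀ i j, S.α j < S.α i → T₁ i j = 0) (h₂ : ∀ i j, S.β j < S.β i → T₂ i j = 0)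
    (h₃ : ∀ i j, S.γ j < S.γ i → T₃ i j = 0) (o : Option S.E) :
    (T₁ ⊗ₖ (T₂ ⊗ₖ T₃)).mulVec (S.tensor N).ofLp (S.supp o) =
      T₁ (S.supp o).1 (S.supp o).1 * (T₂ (S.supp o).2.1 (S.supp o).2.1 *
        T₃ (S.supp o).2.2 (S.supp o).2.2) * (N : ℂ)⁻¹ := by
  rw [Matrix.mulVec, dotProduct, Finset.sum_eq_single (S.supp o), S.tensor_supp]
  · rfl
  · intro w _ hw
    by_cases hr : w ∈ Set.range S.supp
    · obtain ⟨o', rfl⟩ := hr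
      have hne : o ≠ o' := fun h => hw (by rw [h])
      have hor : ¬ (S.α (S.supp o).1 ≤ S.α (S.supp o').1 ∧
          S.β (S.supp o).2.1 ≤ S.β (S.supp o').2.1 ∧
          S.γ (S.supp o).2.2 ≤ S.γ (S.supp o').2.2) :=
        fun h => hne (S.supp_antichain o o' h.1 h.2.1 h.2.2)
      have hz : T₁ (S.supp o).1 (S.supp o').1 * (T₂ (S.supp o).2.1 (S.supp o').2.1 *
          T₃ (S.supp o).2.2 (S.supp o').2.2) = 0 := by
        by_contra hne0
        refine hor ⟨?_, ?_, ?_⟩ <;> by_contra hlt <;> rw [not_le] at hlt <;> apply hne0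
        · rw [h₁ _ _ hlt, zero_mul]
        · rw [h₂ _ _ hlt, zero_mul, mul_zero]
        · rw [h₃ _ _ hlt, mul_zero, mul_zero]
      exact mul_eq_zero_of_left hz _
    · rw [S.tensor_eq_zero N hr, mul_zero]
  · intro h
    exact absurd (Finset.mem_univ _) h

/-- Reduction of the noncommutative group to the torus: every `g` increases the norm of the tensor
at least as much as some diagonal matrix `exp (x, y, z)` of determinant one. If `g` lies in the
ball of radius `R`, then `x`, `y`, `z` have entries at most `R`. -/
theorem exists_torus_le (N : ℕ) (g : G n) : ∃ x y z : Fin n → ℝ,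
    ∑ i, x i = 0 ∧ ∑ i, y i = 0 ∧ ∑ i, z i = 0 ∧
    (∑ o, Real.exp (2 * pairing x y z (S.supp o))) * ((N : ℝ)⁻¹) ^ 2 ≤
      ‖act g (S.tensor N)‖ ^ 2 ∧
    ∀ R, g ∈ geodesicBall n R → ∀ i, x i ≤ R ∧ y i ≤ R ∧ z i ≤ R := by
  obtain ⟨U₁, hU₁, h₁⟩ := exists_unitary_mul_triangular S.α_injective g.1.val
  obtain ⟨U₂, hU₂, h₂⟩ := exists_unitary_mul_triangular S.β_injective g.2.1.val
  obtain ⟨U₃, hU₃, h₃⟩ := exists_unitary_mul_triangular S.γ_injective g.2.2.val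
  obtain ⟨n₁, s₁⟩ := sum_log_norm_diag_eq_zero S.α_injective hU₁ g.1.prop h₁
  obtain ⟨n₂, s₂⟩ := sum_log_norm_diag_eq_zero S.β_injective hU₂ g.2.1.prop h₂
  obtain ⟨n₃, s₃⟩ := sum_log_norm_diag_eq_zero S.γ_injective hU₃ g.2.2.prop h₃
  refine ⟨_, _, _, s₁, s₂, s₃, ?_, ?_⟩
  · have hle : ‖WithLp.toLp 2 (((U₁ * g.1.val) ⊗ₖ ((U₂ * g.2.1.val) ⊗ₖ (U₃ * g.2.2.val))).mulVec
        (S.tensor N).ofLp)‖ ≤ ‖act g (S.tensor N)‖ := by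
      rw [Matrix.mul_kronecker_mul, Matrix.mul_kronecker_mul, ← Matrix.mulVec_mulVec]
      exact norm_mulVec_le_of_mem_unitaryGroup
        (Matrix.kronecker_mem_unitary hU₁ (Matrix.kronecker_mem_unitary hU₂ hU₃)) _
    refine le_trans ?_ (pow_le_pow_left₀ (norm_nonneg _) hle 2)
    rw [EuclideanSpace.norm_sq_eq]
    refine le_trans (le_of_eq ?_) (S.sum_supp_le_sum _ fun w => sq_nonneg _)
    rw [Finset.sum_mul]
    refine Finset.sum_congr rfl fun o _ => ?_
    have h := S.triangular_mulVec_tensor N h₁ h₂ h₃ o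
    simp only [h, norm_mul, norm_inv, Complex.norm_natCast, mul_pow, pairing]
    rw [mul_add, mul_add, Real.exp_add, Real.exp_add]
    have e : ∀ t : ℂ, t ≠ 0 → Real.exp (2 * Real.log ‖t‖) = ‖t‖ ^ 2 := fun t ht => by
      rw [mul_comm, Real.exp_mul, Real.exp_log (norm_pos_iff.mpr ht)]
      norm_cast
    rw [e _ (n₁ _), e _ (n₂ _), e _ (n₃ _)]
    ring
  · rintro R ⟨V₁, V₂, V₃, A₁, A₂, A₃, hV₁, hV₂, hV₃, -, -, -, hR, e₁, e₂, e₃⟩ i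
    have p₁ : 0 ≤ frobeniusSq A₁ := by unfold frobeniusSq; positivity
    have p₂ : 0 ≤ frobeniusSq A₂ := by unfold frobeniusSq; positivity
    have p₃ : 0 ≤ frobeniusSq A₃ := by unfold frobeniusSq; positivity
    refine ⟨?_, ?_, ?_⟩
    · rw [Real.log_le_iff_le_exp (norm_pos_iff.mpr (n₁ i)), e₁]
      exact norm_entry_unitary_mul_exp_le hU₁ hV₁
        ((Real.sqrt_le_sqrt (by linarith)).trans hR) i i
    · rw [Real.log_le_iff_le_exp (norm_pos_iff.mpr (n₂ i)), e₂]
      exact norm_entry_unitary_mul_exp_le hU₂ hV₂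
        ((Real.sqrt_le_sqrt (by linarith)).trans hR) i i
    · rw [Real.log_le_iff_le_exp (norm_pos_iff.mpr (n₃ i)), e₃]
      exact norm_entry_unitary_mul_exp_le hU₃ hV₃
        ((Real.sqrt_le_sqrt (by linarith)).trans hR) i i

/-- The inequality of arithmetic and geometric means on the edges, with its defect: by regularity
the exponents `2 * pairing x y z e` have sum zero. -/
theorem sum_exp_eq {x y z : Fin n → ℝ} (hx : ∑ i, x i = 0) (hy : ∑ i, y i = 0)
    (hz : ∑ i, z i = 0) :
    ∑ o, Real.exp (2 * pairing x y z (S.supp o)) =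
      D * n + Real.exp (2 * pairing x y z S.extra) +
        ∑ e, (Real.exp (2 * pairing x y z (S.edge e)) - 1 - 2 * pairing x y z (S.edge e)) := by
  rw [Fintype.sum_option, Finset.sum_sub_distrib, Finset.sum_sub_distrib, ← Finset.mul_sum,
    S.sum_pairing_edge, hx, hy, hz, Finset.sum_const, Finset.card_univ, nsmul_eq_mul, S.card_edges]
  simp only [supp]
  ring

theorem le_norm_act_sq (N : ℕ) (g : G n) :
    D * n * ((N : ℝ)⁻¹) ^ 2 ≤ ‖act g (S.tensor N)‖ ^ 2 := by
  obtain ⟨x, y, z, hx, hy, hz, h, -⟩ := S.exists_torus_le N g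
  refine le_trans ?_ h
  rw [S.sum_exp_eq hx hy hz]
  gcongr
  have h0 : 0 ≤ ∑ e, (Real.exp (2 * pairing x y z (S.edge e)) - 1 -
      2 * pairing x y z (S.edge e)) :=
    Finset.sum_nonneg fun e _ => by linarith [Real.add_one_le_exp (2 * pairing x y z (S.edge e))]
  linarith [Real.exp_pos (2 * pairing x y z S.extra)]

/-- The element `diag (exp x)` of `SL(n)`, for `x` with sum zero. -/
def torusElement (x : Fin n → ℝ) (hx : ∑ i, x i = 0) : Matrix.SpecialLinearGroup (Fin n) ℂ :=
  ⟨Matrix.diagonal fun i => ((Real.exp (x i) : ℝ) : ℂ), by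
    rw [Matrix.det_diagonal, ← Complex.ofReal_prod, ← Real.exp_sum, hx]
    simp⟩

theorem norm_act_torusElement_sq (N : ℕ) {x y z : Fin n → ℝ} (hx : ∑ i, x i = 0)
    (hy : ∑ i, y i = 0) (hz : ∑ i, z i = 0) :
    ‖act (torusElement x hx, torusElement y hy, torusElement z hz) (S.tensor N)‖ ^ 2 =
      (∑ o, Real.exp (2 * pairing x y z (S.supp o))) * ((N : ℝ)⁻¹) ^ 2 := by
  have hact : ∀ w, act (torusElement x hx, torusElement y hy, torusElement z hz) (S.tensor N) w =
      ((Real.exp (pairing x y z w) : ℝ) : ℂ) * S.tensor N w := by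
    intro w
    simp only [act, torusElement, Matrix.diagonal_kronecker_diagonal, Matrix.mulVec_diagonal,
      pairing, Real.exp_add]
    push_cast
    ring
  rw [EuclideanSpace.norm_sq_eq, S.sum_eq_sum_supp _ fun w hw => by
    rw [hact, S.tensor_eq_zero N hw]; simp]
  rw [Finset.sum_mul]
  refine Finset.sum_congr rfl fun o _ => ?_
  rw [hact, S.tensor_supp, norm_mul, norm_inv, Complex.norm_natCast, mul_pow, Complex.norm_real,
    Real.norm_eq_abs, sq_abs, ← Real.exp_nat_mul]
  norm_cast

/-- The capacity of the tensor of a design is the one of its restriction to the edges: the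
potentials, shifted to have mean zero, give a one-parameter subgroup that fixes the entries on the
edges and sends the additional entry to zero. -/
theorem capa_tensor (hD : 0 < D) (N : ℕ) : capa (S.tensor N) = D * n * ((N : ℝ)⁻¹) ^ 2 := by
  apply le_antisymm
  · have hn : (n : ℝ) ≠ 0 := by
      have := S.extra.1.pos
      positivity
    let a : ℝ := (∑ i, (S.α i : ℝ)) / n
    let b : ℝ := (∑ i, (S.β i : ℝ)) / n
    let c : ℝ := (∑ i, (S.γ i : ℝ)) / n
    have habc : a + b + c = 0 := by
      have h := S.sum_pairing_edge (fun i => S.α i) (fun i => S.β i) fun i => S.γ i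
      have h0 : ∀ e, pairing (fun i => (S.α i : ℝ)) (fun i => S.β i) (fun i => S.γ i)
          (S.edge e) = 0 := fun e => by
        have := S.edge_sum e
        simp only [pairing]
        exact_mod_cast this
      simp only [h0, Finset.sum_const_zero] at h
      have hD' : (D : ℝ) ≠ 0 := by positivity
      have h2 := (mul_eq_zero.mp h.symm).resolve_left hD'
      simp only [a, b, c, ← add_div, h2, zero_div]
    have hsum : ∀ (f : Fin n → ℤ) (t : ℝ),
        ∑ i, t * ((f i : ℝ) - (∑ i, (f i : ℝ)) / n) = 0 := by
      intro f t
      rw [← Finset.mul_sum, Finset.sum_sub_distrib, Finset.sum_const, Finset.card_univ,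
        Fintype.card_fin, nsmul_eq_mul, mul_div_cancel₀ _ hn, sub_self, mul_zero]
    let s : ℝ := S.α S.extra.1 + S.β S.extra.2.1 + S.γ S.extra.2.2
    have hs : s < 0 := by
      have h := S.extra_sum
      simp only [s]
      exact_mod_cast h
    have hbdd : BddBelow (Set.range fun g : G n => ‖act g (S.tensor N)‖ ^ 2) :=
      ⟨0, by rintro _ ⟨g, rfl⟩; positivity⟩
    have hle : ∀ t : ℝ, capa (S.tensor N) ≤
        (D * n + Real.exp (2 * (t * s))) * ((N : ℝ)⁻¹) ^ 2 := by
      intro t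
      refine (ciInf_le hbdd (torusElement _ (hsum S.α t), torusElement _ (hsum S.β t),
        torusElement _ (hsum S.γ t))).trans (le_of_eq ?_)
      rw [S.norm_act_torusElement_sq, S.sum_exp_eq (hsum S.α t) (hsum S.β t) (hsum S.γ t)]
      have hp : ∀ w : Fin n × Fin n × Fin n,
          pairing (fun i => t * ((S.α i : ℝ) - (∑ i, (S.α i : ℝ)) / n))
            (fun i => t * ((S.β i : ℝ) - (∑ i, (S.β i : ℝ)) / n))
            (fun i => t * ((S.γ i : ℝ) - (∑ i, (S.γ i : ℝ)) / n)) w =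
          t * ((S.α w.1 + S.β w.2.1 + S.γ w.2.2 : ℤ) : ℝ) := by
        intro w
        simp only [pairing]
        push_cast
        linear_combination -t * habc
      simp only [hp, S.edge_sum, Int.cast_zero, mul_zero, Real.exp_zero, sub_self,
        Finset.sum_const_zero, add_zero, s]
      push_cast
      rfl
    have hlim : Filter.Tendsto (fun t : ℝ => (D * n + Real.exp (2 * (t * s))) * ((N : ℝ)⁻¹) ^ 2)
        Filter.atTop (nhds ((D * n + 0) * ((N : ℝ)⁻¹) ^ 2)) := by
      refine Filter.Tendsto.mul_const _ (tendsto_const_nhds.add (Real.tendsto_exp_atBot.comp ?_))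
      exact Filter.Tendsto.const_mul_atBot two_pos (Filter.tendsto_id.atTop_mul_const_of_neg hs)
    rw [add_zero] at hlim
    exact ge_of_tendsto' hlim hle
  · exact le_ciInf fun g => S.le_norm_act_sq N g

end Design

/-! ### Near minimizers -/

theorem abs_le_one_of_exp_sub_le {s : ℝ} (h : Real.exp s - 1 - s ≤ 1 / 4) : |s| ≤ 1 := by
  by_contra! hs
  rcases lt_abs.mp hs with h1 | h1
  · have := Real.quadratic_le_exp_of_nonneg (by linarith : 0 ≤ s)
    nlinarith
  · -- `exp s` is compared to its tangent line at `-1`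
    have h2 : Real.exp (-1) - 1 + 1 > 1 / 4 := by
      have h3 : Real.exp (-1) * Real.exp 1 = 1 := by rw [← Real.exp_add]; simp
      have h4 := Real.exp_one_lt_d9
      nlinarith [Real.exp_pos (-1)]
    have h5 : Real.exp s = Real.exp (-1) * Real.exp (s + 1) := by rw [← Real.exp_add]; ring_nf
    have h6 := Real.add_one_le_exp (s + 1)
    have h7 : Real.exp (-1) ≤ 1 := Real.exp_le_one_iff.mpr (by norm_num)
    nlinarith [Real.exp_pos (-1)]

theorem abs_le_of_sum_eq_zero {n : ℕ} {x : Fin n → ℝ} (hx : ∑ i, x i = 0) {R : ℝ}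
    (hR : ∀ i, x i ≤ R) (i : Fin n) : |x i| ≤ n * R := by
  have h1 : ∑ j, (R - x j) = n * R := by
    rw [Finset.sum_sub_distrib, hx, sub_zero]
    simp
  have h2 : R - x i ≤ n * R := by
    rw [← h1]
    exact Finset.single_le_sum (f := fun j => R - x j) (fun j _ => sub_nonneg.mpr (hR j))
      (Finset.mem_univ i)
  have h3 : R ≤ n * R ∧ 0 ≤ R := by
    have hn : (1 : ℝ) ≤ n := by exact_mod_cast i.pos
    have h0 : 0 ≤ R := by
      by_contra! h
      have : ∑ j, x j < 0 := by
        refine Finset.sum_neg (fun j _ => (hR j).trans_lt h) ⟨i, Finset.mem_univ i⟩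
      linarith
    exact ⟨by nlinarith, h0⟩
  rw [abs_le]
  exact ⟨by linarith, (hR i).trans h3.1⟩

/-- The additional hyperedge of a design is close to the span of the edges: it differs by a vector
of `ℓ¹` norm at most `δ` from a linear combination of edges whose coefficients have absolute values
of sum at most `B`. This is expressed in the dual form, by functionals that are bounded by `1` on
the edges and have entries at most `M`. -/
def Design.IsNearSpan {n D : ℕ} (S : Design n D) (B δ : ℝ) : Prop :=
  ∀ (x y z : Fin n → ℝ) (M : ℝ), (∀ i, |x i| ≤ M ∧ |y i| ≤ M ∧ |z i| ≤ M) →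
    (∀ e, |pairing x y z (S.edge e)| ≤ 1) → |pairing x y z S.extra| ≤ B + δ * M

/-- A near minimizer has all edge weights bounded above and below by the defect in the inequality
of means, and a tiny weight on the additional hyperedge. As the latter is almost a combination
of edges, this takes a large group element. -/
theorem Design.log_le_of_norm_act_lt {n D : ℕ} (S : Design n D) (hD : 0 < D) {B δ : ℝ}
    (hS : S.IsNearSpan B δ) {N : ℕ} (hN0 : 0 < N) (hN : (N : ℝ) ^ 2 ≤ 4 * (D * n)) {ε R : ℝ}
    (hε : 0 < ε) (hε' : 16 * (D * n) * ε ≤ 1) {g : G n} (hg : g ∈ geodesicBall n R)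
    (hlt : ‖act g (S.tensor N)‖ ^ 2 < capa (S.tensor N) + ε) :
    Real.log (1 / ε) ≤ Real.log (4 * (D * n)) + B + 2 * δ * n * R := by
  obtain ⟨x, y, z, hx, hy, hz, hle, hR⟩ := S.exists_torus_le N g
  have hR := hR R hg
  have hDn : (0 : ℝ) < D * n := by
    have := S.extra.1.pos
    positivity
  rw [S.capa_tensor hD] at hlt
  have hN1 : (0 : ℝ) < ((N : ℝ)⁻¹) ^ 2 := by positivity
  have hN2 : ((N : ℝ)⁻¹) ^ 2 * (N : ℝ) ^ 2 = 1 := by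
    rw [← mul_pow, inv_mul_cancel₀ (by positivity), one_pow]
  have h1 := hle.trans_lt hlt
  have h2 : ∑ o, Real.exp (2 * pairing x y z (S.supp o)) < D * n + 4 * (D * n) * ε := by
    have h3 : ε ≤ 4 * (D * n) * ε * ((N : ℝ)⁻¹) ^ 2 := by
      have : ε * 1 ≤ ε * (((N : ℝ)⁻¹) ^ 2 * (4 * (D * n))) := by
        rw [← hN2]
        gcongr
      linarith
    refine lt_of_mul_lt_mul_right (a := ((N : ℝ)⁻¹) ^ 2) ?_ hN1.le
    linarith
  rw [S.sum_exp_eq hx hy hz] at h2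
  have hnn : ∀ e, 0 ≤ Real.exp (2 * pairing x y z (S.edge e)) - 1 -
      2 * pairing x y z (S.edge e) := fun e => by
    linarith [Real.add_one_le_exp (2 * pairing x y z (S.edge e))]
  have hsum := Finset.sum_nonneg fun e (_ : e ∈ Finset.univ) => hnn e
  have hpos := Real.exp_pos (2 * pairing x y z S.extra)
  have hedge : ∀ e, |2 * pairing x y z (S.edge e)| ≤ 1 := fun e => by
    apply abs_le_one_of_exp_sub_le
    have := Finset.single_le_sum (fun e _ => hnn e) (Finset.mem_univ e)
    linarith
  have hextra : 2 * pairing x y z S.extra ≤ Real.log (4 * (D * n)) - Real.log (1 / ε) := by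
    rw [one_div, Real.log_inv, sub_neg_eq_add, ← Real.log_mul (by positivity) hε.ne',
      Real.le_log_iff_exp_le (by positivity)]
    linarith
  have h4 := hS (fun i => 2 * x i) (fun i => 2 * y i) (fun i => 2 * z i) (2 * (n * R))
    (fun i => by
      simp only [abs_mul, abs_two]
      exact ⟨by linarith [abs_le_of_sum_eq_zero hx (fun i => (hR i).1) i],
        by linarith [abs_le_of_sum_eq_zero hy (fun i => (hR i).2.1) i],
        by linarith [abs_le_of_sum_eq_zero hz (fun i => (hR i).2.2) i]⟩)
    (fun e => by
      have := hedge e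
      rw [pairing] at this ⊢
      rwa [← mul_add, ← mul_add])
  have h5 : pairing (fun i => 2 * x i) (fun i => 2 * y i) (fun i => 2 * z i) S.extra =
      2 * pairing x y z S.extra := by
    simp only [pairing]
    ring
  rw [h5] at h4
  linarith [(abs_le.mp h4).1]

/-! ### Choice of the normalization and the radius -/

theorem natCast_le_two_rpow (n : ℕ) : (n : ℝ) ≤ (2 : ℝ) ^ (2 * (n : ℝ) / 3) := by
  have h : ∀ n : ℕ, n ^ 3 ≤ 4 ^ n := by
    intro n
    induction n with
    | zero => norm_num
    | succ k ih =>
      rcases Nat.lt_or_ge k 2 with h | h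
      · interval_cases k <;> norm_num
      · have : (k + 1) ^ 3 ≤ 4 * k ^ 3 := by
          obtain ⟨j, rfl⟩ := Nat.exists_eq_add_of_le h
          ring_nf
          nlinarith [sq_nonneg j, Nat.zero_le (j ^ 3)]
        rw [pow_succ 4 k]
        omega
  have h1 : ((2 : ℝ) ^ (2 * (n : ℝ) / 3)) ^ 3 = 4 ^ n := by
    rw [← Real.rpow_natCast, ← Real.rpow_mul (by norm_num)]
    have : 2 * (n : ℝ) / 3 * ((3 : ℕ) : ℝ) = ((2 * n : ℕ) : ℝ) := by push_cast; ring
    rw [this, Real.rpow_natCast, pow_mul]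
    norm_num
  refine le_of_pow_le_pow_left₀ three_ne_zero (by positivity) ?_
  rw [h1]
  exact_mod_cast h n

/-- A design whose additional hyperedge is exponentially close to the span of the edges gives a
tensor without near minimizers in a ball of exponential radius. The tensor is normalized by the
least integer `N` that makes its norm at most one. -/
theorem Design.exists_tensor {n D : ℕ} (S : Design n D) (hn : 3 ≤ n) (hD : 0 < D) (hD3 : D ≤ 3)
    (hS : S.IsNearSpan (2 * n + 9) (384 / 2 ^ n)) {ε : ℝ} (hε : 0 < ε)
    (hL : 100 * (n : ℝ) ^ 2 ≤ Real.log (1 / ε)) :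
    ∃ v : Tensor n,
      (numNonzero v : ℝ) ≤ 4 * (n : ℝ) ∧
      (∀ x, v x ≠ 0 → ∃ q : ℚ, v x = (q : ℂ) ∧
        (bitComplexity q : ℝ) ≤ 1 * (Real.log (n : ℝ) + Real.log (1 / ε))) ∧
      1 / 4 ≤ capa v ∧ capa v ≤ 1 ∧ 1 / 2 ≤ ‖v‖ ∧ ‖v‖ ≤ 1 ∧
      ∃ R : ℝ, 1 / 2000 * ((2 : ℝ) ^ ((n : ℝ) / 3) * Real.log (1 / ε)) ≤ R ∧
        capa v + ε ≤ ⨅ g : geodesicBall n R, ‖act g.val v‖ ^ 2 := by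
  set L := Real.log (1 / ε) with hLdef
  have hn' : (3 : ℝ) ≤ n := by exact_mod_cast hn
  have hD1 : (1 : ℝ) ≤ D := by exact_mod_cast hD
  have hD3' : (D : ℝ) ≤ 3 := by exact_mod_cast hD3
  have hDn : (D : ℝ) * n ≤ 3 * n := by gcongr
  have hDn0 : (0 : ℝ) < D * n := by positivity
  have hL0 : 100 * (n : ℝ) ≤ L / 3 := by nlinarith
  obtain ⟨N, hN0, hNlow, hNup, hNn⟩ : ∃ N : ℕ, 0 < N ∧ (D * n + 1 : ℝ) ≤ (N : ℝ) ^ 2 ∧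
      (N : ℝ) ^ 2 ≤ 4 * (D * n) ∧ (N : ℝ) ≤ 4 * n := by
    have h1 := Nat.sqrt_le' (D * n)
    have h2 := Nat.succ_le_succ_sqrt' (D * n)
    have h3 : 0 < Nat.sqrt (D * n) := Nat.sqrt_pos.mpr (by positivity)
    have h4 := Nat.sqrt_le_self (D * n)
    have h5 : D * n ≤ 3 * n := by gcongr
    refine ⟨Nat.sqrt (D * n) + 1, Nat.succ_pos _, ?_, ?_, ?_⟩
    · exact_mod_cast h2
    · have : (Nat.sqrt (D * n) + 1) ^ 2 ≤ 4 * (D * n) := by nlinarith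
      exact_mod_cast this
    · have : Nat.sqrt (D * n) + 1 ≤ 4 * n := by omega
      exact_mod_cast this
  have hNsq : (0 : ℝ) < (N : ℝ) ^ 2 := by positivity
  have hinv : ((N : ℝ)⁻¹) ^ 2 = 1 / (N : ℝ) ^ 2 := by rw [inv_pow, one_div]
  have hcapa : capa (S.tensor N) = D * n / (N : ℝ) ^ 2 := by
    rw [S.capa_tensor hD, hinv, mul_one_div]
  have hnorm : ‖S.tensor N‖ ^ 2 = (D * n + 1) / (N : ℝ) ^ 2 := by
    rw [S.norm_tensor_sq, hinv, mul_one_div]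
  have hlogn : 0 ≤ Real.log n := Real.log_natCast_nonneg n
  refine ⟨S.tensor N, ?_, ?_, ?_, ?_, ?_, ?_, 1 / 2000 * ((2 : ℝ) ^ ((n : ℝ) / 3) * L), le_rfl, ?_⟩
  · linarith [S.numNonzero_tensor_le N]
  · intro w hw
    have hr : w ∈ Set.range S.supp := by
      by_contra h
      exact hw (S.tensor_eq_zero N h)
    obtain ⟨o, rfl⟩ := hr
    refine ⟨((N : ℚ))⁻¹, by rw [S.tensor_supp]; push_cast; rfl, ?_⟩
    have hb : bitComplexity ((N : ℚ))⁻¹ ≤ 1 + N := by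
      have h1 : ((N : ℚ)⁻¹).num = 1 := by
        simp [hN0]
      have h2 : ((N : ℚ)⁻¹).den = N := by
        simp [hN0.ne']
      rw [bitComplexity, h1, h2]
      have h3 : N.size ≤ N := Nat.size_le.mpr N.lt_two_pow_self
      simpa using h3
    have hb' : (bitComplexity ((N : ℚ))⁻¹ : ℝ) ≤ 1 + N := by exact_mod_cast hb
    linarith
  · rw [hcapa, le_div_iff₀ hNsq]
    linarith
  · rw [hcapa, div_le_one hNsq]
    linarith
  · refine le_of_pow_le_pow_left₀ two_ne_zero (norm_nonneg _) ?_
    rw [hnorm, le_div_iff₀ hNsq]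
    linarith
  · refine le_of_pow_le_pow_left₀ two_ne_zero zero_le_one ?_
    rw [hnorm, one_pow, div_le_one hNsq]
    exact hNlow
  · set R := 1 / 2000 * ((2 : ℝ) ^ ((n : ℝ) / 3) * L) with hR
    have hLpos : 0 < L := by linarith
    have hRpos : 0 ≤ R := by positivity
    have hne : Nonempty (geodesicBall n R) := by
      refine ⟨⟨1, 1, 1, 1, 0, 0, 0, one_mem _, one_mem _, one_mem _, ?_⟩⟩
      simp [frobeniusSq, hRpos]
    refine le_ciInf fun g => ?_
    by_contra! hlt
    have hεL : ε = Real.exp (-L) := by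
      rw [hLdef, one_div, Real.log_inv, neg_neg, Real.exp_log hε]
    have hε' : 16 * (D * n) * ε ≤ 1 := by
      have h1 : L + 1 ≤ Real.exp L := Real.add_one_le_exp L
      have h2 : Real.exp L * ε = 1 := by rw [hεL, ← Real.exp_add]; simp
      rw [← h2]
      gcongr
      linarith
    have h := S.log_le_of_norm_act_lt hD hS hN0 hNup hε hε' g.prop hlt
    have hlog : Real.log (4 * (D * n)) ≤ 12 * n := by
      have := Real.log_le_sub_one_of_pos (by positivity : (0 : ℝ) < 4 * (D * n))
      linarith
    have hpow : (2 : ℝ) ^ n = (2 : ℝ) ^ ((n : ℝ) / 3) * (2 : ℝ) ^ (2 * (n : ℝ) / 3) := by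
      rw [← Real.rpow_add two_pos, ← Real.rpow_natCast]
      congr 1
      ring
    have hfar : 2 * (384 / (2 : ℝ) ^ n) * n * R ≤ 768 / 2000 * L := by
      have hp : (0 : ℝ) < 2 ^ ((n : ℝ) / 3) := by positivity
      have hp' : (0 : ℝ) < 2 ^ (2 * (n : ℝ) / 3) := by positivity
      have heq : 2 * (384 / (2 : ℝ) ^ n) * n * R =
          768 / 2000 * L * (n / (2 : ℝ) ^ (2 * (n : ℝ) / 3)) := by
        rw [hR, hpow]
        field_simp
        norm_num
      rw [heq]
      exact mul_le_of_le_one_right (by positivity)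
        ((div_le_one hp').mpr (natCast_le_two_rpow n))
    linarith

/-! ### The diagonal design -/

/-- The design with edges `(i, i, i)` and the additional hyperedge `(0, 2, 1)`. -/
def diagonalDesign (n : ℕ) (hn : 3 ≤ n) : Design n 1 where
  E := Fin n
  edge i := (i, i, i)
  extra := (⟨0, by omega⟩, ⟨2, by omega⟩, ⟨1, by omega⟩)
  α i := if i.val = 0 then -2 else i.val
  β i := i.val
  γ i := if i.val = 0 then 2 else -(2 * i.val)
  α_injective i j h := by
    ext
    simp only at h
    split_ifs at h <;> omega
  β_injective i j h := by
    ext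
    simp only at h
    omega
  γ_injective i j h := by
    ext
    simp only at h
    split_ifs at h <;> omega
  edge_injective i j h := congrArg Prod.fst h
  edge_sum i := by
    simp only
    split_ifs <;> omega
  extra_sum := by norm_num
  not_extra_le i := by
    simp only
    split_ifs <;> omega
  regular₁ x := by simp
  regular₂ x := by simp
  regular₃ x := by simp

theorem diagonalDesign_isNearSpan {n : ℕ} (hn : 3 ≤ n) (hn' : n ≤ 7) :
    (diagonalDesign n hn).IsNearSpan (2 * n + 9) (384 / 2 ^ n) := by
  intro x y z M hM _
  have h : |pairing x y z (diagonalDesign n hn).extra| ≤ 3 * M := by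
    rw [pairing]
    refine (abs_add_three _ _ _).trans ?_
    linarith [(hM (diagonalDesign n hn).extra.1).1, (hM (diagonalDesign n hn).extra.2.1).2.1,
      (hM (diagonalDesign n hn).extra.2.2).2.2]
  have hM0 : 0 ≤ M := (abs_nonneg _).trans (hM ⟨0, by omega⟩).1
  have h2 : (3 : ℝ) ≤ 384 / 2 ^ n := by
    rw [le_div_iff₀ (by positivity)]
    have : (2 : ℝ) ^ n ≤ 2 ^ 7 := pow_le_pow_right₀ one_le_two hn'
    linarith
  have h3 : 3 * M ≤ 384 / 2 ^ n * M := by gcongr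
  have h4 : (0 : ℝ) ≤ 2 * n + 9 := by positivity
  linarith

/-! ### The chain design -/

/-- The `k`-th elementof `Fin (m + 4)`, for `k < m + 4`. -/
def vert (m k : ℕ) : Fin (m + 4) := Fin.ofNat (m + 4) k

theorem val_vert {m k : ℕ} (hk : k < m + 4) : (vert m k).val = k := Nat.mod_eq_of_lt hk

/-- The vertices that occur in the closing edges: the two ends `0` and `m` of the chain and the
three vertices outside it. -/
def closingVertex (m : ℕ) : Fin 5 → Fin (m + 4) :=
  ![vert m 0, vert m m, vert m (m + 1), vert m (m + 2), vert m (m + 3)]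

theorem closingVertex_injective {m : ℕ} (hm : 0 < m) : Function.Injective (closingVertex m) := by
  intro i j h
  have e0 : (vert m 0).val = 0 := val_vert (by omega)
  have e1 : (vert m m).val = m := val_vert (by omega)
  have e2 : (vert m (m + 1)).val = m + 1 := val_vert (by omega)
  have e3 : (vert m (m + 2)).val = m + 2 := val_vert (by omega)
  have e4 : (vert m (m + 3)).val = m + 3 := val_vert (by omega)
  fin_cases i <;> fin_cases j <;>
    simp [closingVertex, Fin.ext_iff, e0, e1, e2, e3, e4] at h ⊢ <;> omega

/-- The closing edges, in terms of `closingVertex`. -/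
def closingTriple : Fin 12 → Fin 5 × Fin 5 × Fin 5 :=
  ![(1, 2, 3), (1, 3, 2), (2, 1, 3), (2, 3, 1), (3, 1, 2), (3, 2, 1),
    (4, 4, 2), (4, 2, 4), (2, 4, 4), (4, 0, 3), (3, 4, 0), (0, 3, 4)]

theorem closingTriple_injective : Function.Injective closingTriple := by
  unfold closingTriple
  decide

/-- The edges of the chain design: the permutations of `(k, k, k + 1)` for `k < m`, and the closing
edges, which make the hypergraph regular. -/
def chainEdge (m : ℕ) : Fin m × Fin 3 ⊕ Fin 12 → Fin (m + 4) × Fin (m + 4) × Fin (m + 4)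
  | .inl (k, j) => ![(vert m k, vert m k, vert m (k + 1)), (vert m k, vert m (k + 1), vert m k),
      (vert m (k + 1), vert m k, vert m k)] j
  | .inr e => (closingVertex m (closingTriple e).1, closingVertex m (closingTriple e).2.1,
      closingVertex m (closingTriple e).2.2)

/-- The potential of the chain design. With `T = (-2) ^ m`, it is `3 (-2) ^ k` at the vertices
`k ≤ m` of the chain, and `-2 (T - 1)`, `-(T + 2)`, `T - 1` at the other three. -/
def chainPotential (m : ℕ) (i : Fin (m + 4)) : ℤ :=
  if i.val ≤ m then 3 * (-2) ^ i.val else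
  if i.val = m + 1 then -2 * ((-2) ^ m - 1) else
  if i.val = m + 2 then -((-2) ^ m + 2) else (-2) ^ m - 1

theorem chainPotential_vert {m k : ℕ} (hk : k ≤ m) :
    chainPotential m (vert m k) = 3 * (-2) ^ k := by
  rw [chainPotential, val_vert (by omega), if_pos hk]

theorem chainPotential_closingVertex (m : ℕ) (l : Fin 5) :
    chainPotential m (closingVertex m l) =
      ![3, 3 * (-2) ^ m, -2 * ((-2) ^ m - 1), -((-2) ^ m + 2), (-2) ^ m - 1] l := by
  fin_cases l
  · simp [closingVertex, chainPotential_vert]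
  · simp [closingVertex, chainPotential_vert]
  · simp [closingVertex, chainPotential, val_vert]
  · simp [closingVertex, chainPotential, val_vert]
  · simp [closingVertex, chainPotential, val_vert]

theorem neg_two_pow_bound {m : ℕ} (hm : 4 ≤ m) : (16 : ℤ) ≤ (-2) ^ m ∨ (-2 : ℤ) ^ m ≤ -16 := by
  have h : (2 : ℤ) ^ 4 ≤ 2 ^ m := pow_le_pow_right₀ one_le_two hm
  rcases Nat.even_or_odd m with he | ho
  · left
    rw [he.neg_pow]
    linarith
  · right
    rw [ho.neg_pow]
    linarith

theorem neg_two_pow_injective {k l : ℕ} (h : (-2 : ℤ) ^ k = (-2) ^ l) : k = l := by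
  have h2 := congrArg Int.natAbs h
  rw [Int.natAbs_pow, Int.natAbs_pow] at h2
  exact Nat.pow_right_injective (le_refl 2) h2

theorem neg_two_pow_cases (k : ℕ) :
    (-2 : ℤ) ^ k = 1 ∨ (-2 : ℤ) ^ k = -2 ∨ (4 : ℤ) ∣ (-2) ^ k := by
  rcases k with _ | _ | k
  · left; rfl
  · right; left; rfl
  · right; right
    exact ⟨(-2) ^ k, by ring⟩

theorem chainPotential_injective {m : ℕ} (hm : 4 ≤ m) :
    Function.Injective (chainPotential m) := by
  intro i j h
  ext
  -- The values outside the chain are congruent to `2` or `3` modulo `4`, so on the chain they could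
  -- only coincide with the values `3` and `-6` at `0` and `1`, and `16 ≤ |T|` excludes that.
  have hT := neg_two_pow_bound hm
  have hT4 : (4 : ℤ) ∣ (-2) ^ m :=
    (neg_two_pow_cases m).elim (fun h => by omega) fun h => h.elim (fun h => by omega) id
  have hi := neg_two_pow_cases i.val
  have hj := neg_two_pow_cases j.val
  have hi' := i.isLt
  have hj' := j.isLt
  simp only [chainPotential] at h
  by_cases h1 : i.val ≤ m <;> by_cases h2 : j.val ≤ m
  · rw [if_pos h1, if_pos h2] at h
    exact neg_two_pow_injective (by omega)
  · exfalso
    rw [if_pos h1, if_neg h2] at h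
    generalize (-2 : ℤ) ^ i.val = a at *
    generalize (-2 : ℤ) ^ m = T at *
    split_ifs at h <;> omega
  · exfalso
    rw [if_neg h1, if_pos h2] at h
    generalize (-2 : ℤ) ^ j.val = a at *
    generalize (-2 : ℤ) ^ m = T at *
    split_ifs at h <;> omega
  · rw [if_neg h1, if_neg h2] at h
    generalize (-2 : ℤ) ^ m = T at *
    split_ifs at h <;> omega

theorem chainEdge_injective {m : ℕ} (hm : 0 < m) : Function.Injective (chainEdge m) := by
  have hmix : ∀ p e, chainEdge m (.inl p) ≠ chainEdge m (.inr e) := by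
    rintro ⟨k, j⟩ e h
    have hk := k.isLt
    -- every closing edge contains a vertex outside the chain
    have hle : (chainEdge m (.inl (k, j))).1.val ≤ m ∧
        (chainEdge m (.inl (k, j))).2.1.val ≤ m ∧ (chainEdge m (.inl (k, j))).2.2.val ≤ m := by
      have h1 : (vert m k).val = k := val_vert (by omega)
      have h2 : (vert m (k + 1)).val = k + 1 := val_vert (by omega)
      fin_cases j <;> simp [chainEdge, h1, h2]
    rw [h] at hle
    have e1 : (vert m (m + 1)).val = m + 1 := val_vert (by omega)
    have e2 : (vert m (m + 2)).val = m + 2 := val_vert (by omega)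
    have e3 : (vert m (m + 3)).val = m + 3 := val_vert (by omega)
    fin_cases e <;> simp [chainEdge, closingTriple, closingVertex, e1, e2, e3] at hle
  rintro (⟨k, j⟩ | e) (⟨k', j'⟩ | e') h
  · have hk := k.isLt
    have hk' := k'.isLt
    have h1 : (vert m k).val = k := val_vert (by omega)
    have h2 : (vert m (k + 1)).val = k + 1 := val_vert (by omega)
    have h3 : (vert m k').val = k' := val_vert (by omega)
    have h4 : (vert m (k' + 1)).val = k' + 1 := val_vert (by omega)
    have hkj : k.val = k'.val ∧ j = j' := by
      fin_cases j <;> fin_cases j' <;>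
        simp [chainEdge, Fin.ext_iff, h1, h2, h3, h4] at h ⊢ <;> omega
    rw [Fin.ext hkj.1, hkj.2]
  · exact absurd h (hmix _ _)
  · exact absurd h.symm (hmix _ _)
  · simp only [chainEdge, Prod.mk.injEq] at h
    have hv := closingVertex_injective hm
    exact congrArg Sum.inr (closingTriple_injective
      (Prod.ext (hv h.1) (Prod.ext (hv h.2.1) (hv h.2.2))))

theorem sum_eq_sum_vert (m : ℕ) (x : Fin (m + 4) → ℝ) :
    ∑ i, x i = ∑ k ∈ Finset.range m, x (vert m k) + x (vert m m) + x (vert m (m + 1)) +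
      x (vert m (m + 2)) + x (vert m (m + 3)) := by
  rw [← Finset.sum_range_succ, ← Finset.sum_range_succ, ← Finset.sum_range_succ,
    ← Finset.sum_range_succ, ← Fin.sum_univ_eq_sum_range (fun k => x (vert m k))]
  refine Finset.sum_congr rfl fun i _ => ?_
  rw [Fin.ext (val_vert i.isLt)]

theorem sum_vert_succ (m : ℕ) (x : Fin (m + 4) → ℝ) :
    ∑ k ∈ Finset.range m, x (vert m (k + 1)) =
      ∑ k ∈ Finset.range m, x (vert m k) + x (vert m m) - x (vert m 0) := by
  rw [← Finset.sum_range_succ, Finset.sum_range_succ']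
  ring

theorem sum_chainEdge (m : ℕ) (F : Fin (m + 4) × Fin (m + 4) × Fin (m + 4) → ℝ) :
    ∑ e, F (chainEdge m e) = ∑ k ∈ Finset.range m,
      (F (vert m k, vert m k, vert m (k + 1)) + F (vert m k, vert m (k + 1), vert m k) +
        F (vert m (k + 1), vert m k, vert m k)) + ∑ e, F (chainEdge m (.inr e)) := by
  rw [Fintype.sum_sum_type, Fintype.sum_prod_type, Finset.sum_range]
  congr 1
  refine Finset.sum_congr rfl fun k _ => ?_
  rw [Fin.sum_univ_three]
  rfl

theorem sum_closingTriple (f : Fin 5 → ℝ) :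
    ∑ e, f (closingTriple e).1 = f 0 + 2 * f 1 + 3 * f 2 + 3 * f 3 + 3 * f 4 ∧
    ∑ e, f (closingTriple e).2.1 = f 0 + 2 * f 1 + 3 * f 2 + 3 * f 3 + 3 * f 4 ∧
    ∑ e, f (closingTriple e).2.2 = f 0 + 2 * f 1 + 3 * f 2 + 3 * f 3 + 3 * f 4 := by
  refine ⟨?_, ?_, ?_⟩ <;> simp [Fin.sum_univ_succ, closingTriple] <;> ring

/-- The chain design, of degree `3`. With `T = (-2) ^ m`, the additional hyperedge has the potentials
`T - 1`, `-(T + 2)`, `-6`, and an edge above it would have potentials exceeding these by at most `9`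
in total. The relation `S (k + 1) = -2 S k` for the sum `S k` of a functional over
`(k, k, k)`, valid up to edges, is responsible for the exponential growth along the chain. -/
def chainDesign (m : ℕ) (hm : 4 ≤ m) : Design (m + 4) 3 where
  E := Fin m × Fin 3 ⊕ Fin 12
  edge := chainEdge m
  extra := (vert m (m + 3), vert m (m + 2), vert m 1)
  α := chainPotential m
  β := chainPotential m
  γ := chainPotential m
  α_injective := chainPotential_injective hm
  β_injective := chainPotential_injective hm
  γ_injective := chainPotential_injective hm
  edge_injective := chainEdge_injective (by omega)
  edge_sum := by
    rintro (⟨k, j⟩ | e)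
    · have hk := k.isLt
      have h1 := chainPotential_vert (m := m) (k := k) (by omega)
      have h2 := chainPotential_vert (m := m) (k := k + 1) (by omega)
      fin_cases j <;> simp [chainEdge, h1, h2] <;> ring
    · fin_cases e <;> simp [chainEdge, closingTriple, chainPotential_closingVertex] <;> ring
  extra_sum := by
    have h1 := chainPotential_vert (m := m) (k := 1) (by omega)
    have h2 := chainPotential_closingVertex m 3
    have h3 := chainPotential_closingVertex m 4
    simp [closingVertex] at h2 h3
    simp only [h1, h2, h3]
    omega
  not_extra_le := by
    have hT := neg_two_pow_bound hm
    have g1 := chainPotential_vert (m := m) (k := 1) (by omega)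
    have g2 := chainPotential_closingVertex m 3
    have g3 := chainPotential_closingVertex m 4
    simp [closingVertex] at g2 g3
    rintro (⟨k, j⟩ | e)
    · have hk := k.isLt
      have h1 := chainPotential_vert (m := m) (k := k) (by omega)
      have h2 := chainPotential_vert (m := m) (k := k + 1) (by omega)
      rw [pow_succ] at h2
      simp only [g1, g2, g3]
      fin_cases j <;> simp [chainEdge, h1, h2] <;> omega
    · simp only [g1, g2, g3]
      fin_cases e <;> simp [chainEdge, closingTriple, chainPotential_closingVertex] <;> omega
  regular₁ x := by
    have h := (sum_closingTriple fun l => x (closingVertex m l)).1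
    rw [sum_chainEdge m fun w => x w.1, sum_eq_sum_vert m x]
    simp only [Finset.sum_add_distrib, sum_vert_succ, chainEdge, h]
    simp only [closingVertex, Matrix.cons_val]
    push_cast
    ring
  regular₂ x := by
    have h := (sum_closingTriple fun l => x (closingVertex m l)).2.1
    rw [sum_chainEdge m fun w => x w.2.1, sum_eq_sum_vert m x]
    simp only [Finset.sum_add_distrib, sum_vert_succ, chainEdge, h]
    simp only [closingVertex, Matrix.cons_val]
    push_cast
    ring
  regular₃ x := by
    have h := (sum_closingTriple fun l => x (closingVertex m l)).2.2
    rw [sum_chainEdge m fun w => x w.2.2, sum_eq_sum_vert m x]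
    simp only [Finset.sum_add_distrib, sum_vert_succ, chainEdge, h]
    simp only [closingVertex, Matrix.cons_val]
    push_cast
    ring

theorem abs_le_of_approx_doubling (s : ℕ → ℝ) (m : ℕ) (h : ∀ k < m, |s (k + 1) + 2 * s k| ≤ 3) :
    |s 0| ≤ 3 * (1 - 1 / 2 ^ m) + |s m| / 2 ^ m := by
  induction m with
  | zero => simp
  | succ m ih =>
    have h1 := ih fun k hk => h k (by omega)
    have h2 : |s m| ≤ (|s (m + 1)| + 3) / 2 := by
      have h3 := h m (by omega)
      have h4 := abs_sub (s (m + 1) + 2 * s m) (s (m + 1))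
      rw [add_sub_cancel_left, abs_mul, abs_two] at h4
      linarith
    have h3 : |s m| / 2 ^ m ≤ (|s (m + 1)| + 3) / 2 / 2 ^ m := by gcongr
    have h4 : 3 * (1 - 1 / 2 ^ (m + 1)) + |s (m + 1)| / 2 ^ (m + 1) =
        3 * (1 - 1 / 2 ^ m) + (|s (m + 1)| + 3) / 2 / 2 ^ m := by
      rw [pow_succ]
      field_simp
      ring
    linarith

theorem abs_sub_le_of_steps (r : ℕ → ℝ) (m : ℕ) (h : ∀ k < m, |r (k + 1) - r k| ≤ 2) :
    |r m - r 0| ≤ 2 * m := by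
  induction m with
  | zero => simp
  | succ m ih =>
    have h1 := ih fun k hk => h k (by omega)
    have h2 := abs_sub_le (r (m + 1)) (r m) (r 0)
    have h3 := h m (by omega)
    push_cast
    linarith

theorem chainDesign_isNearSpan {m : ℕ} (hm : 4 ≤ m) :
    (chainDesign m hm).IsNearSpan (2 * (m + 4 : ℕ) + 9) (384 / 2 ^ (m + 4)) := by
  intro x y z M hM hE
  have hM0 : 0 ≤ M := (abs_nonneg _).trans (hM (vert m 0)).1
  have c0 : ∀ k < m, |x (vert m k) + y (vert m k) + z (vert m (k + 1))| ≤ 1 := fun k hk =>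
    hE (.inl (⟨k, hk⟩, 0))
  have c1 : ∀ k < m, |x (vert m k) + y (vert m (k + 1)) + z (vert m k)| ≤ 1 := fun k hk =>
    hE (.inl (⟨k, hk⟩, 1))
  have c2 : ∀ k < m, |x (vert m (k + 1)) + y (vert m k) + z (vert m k)| ≤ 1 := fun k hk =>
    hE (.inl (⟨k, hk⟩, 2))
  have e1 : |x (vert m 0) + y (vert m (m + 2)) + z (vert m (m + 3))| ≤ 1 := hE (.inr 11)
  have e2 : |x (vert m (m + 3)) + y (vert m (m + 3)) + z (vert m (m + 1))| ≤ 1 := hE (.inr 6)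
  have e3 : |x (vert m (m + 1)) + y (vert m (m + 3)) + z (vert m (m + 3))| ≤ 1 := hE (.inr 8)
  have e4 : |x (vert m (m + 1)) + y (vert m (m + 2)) + z (vert m m)| ≤ 1 := hE (.inr 3)
  have e5 : |x (vert m m) + y (vert m (m + 2)) + z (vert m (m + 1))| ≤ 1 := hE (.inr 1)
  have hs := abs_le_of_approx_doubling
    (fun k => x (vert m k) + y (vert m k) + z (vert m k)) m fun k hk => by
      have h := abs_le.mp (c0 k hk)
      have h' := abs_le.mp (c1 k hk)
      have h'' := abs_le.mp (c2 k hk)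
      rw [abs_le]
      constructor <;> linarith
  have hr := abs_sub_le_of_steps (fun k => x (vert m k) - z (vert m k)) m fun k hk => by
    have h := abs_le.mp (c0 k hk)
    have h'' := abs_le.mp (c2 k hk)
    rw [abs_le]
    constructor <;> linarith
  have hm0 := c0 0 (by omega)
  have hSm : |x (vert m m) + y (vert m m) + z (vert m m)| / 2 ^ m ≤ 3 * M / 2 ^ m := by
    gcongr
    refine (abs_add_three _ _ _).trans ?_
    linarith [(hM (vert m m)).1, (hM (vert m m)).2.1, (hM (vert m m)).2.2]
  have hδ : 3 * M / 2 ^ m ≤ 384 / 2 ^ (m + 4) * M := by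
    rw [pow_add, div_mul_eq_mul_div, div_le_div_iff₀ (by positivity) (by positivity)]
    have : 0 ≤ M * 2 ^ m := by positivity
    linarith
  have hone : (0 : ℝ) ≤ 1 / 2 ^ m := by positivity
  have hS0 : |x (vert m 0) + y (vert m 0) + z (vert m 0)| ≤ 3 + 384 / 2 ^ (m + 4) * M := by
    linarith
  change |x (vert m (m + 3)) + y (vert m (m + 2)) + z (vert m 1)| ≤ _
  -- modulo edges, the additional hyperedge is the negative of `(0, 0, 0)`
  have key : x (vert m (m + 3)) + y (vert m (m + 2)) + z (vert m 1) =
      (x (vert m 0) + y (vert m (m + 2)) + z (vert m (m + 3))) +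
      (x (vert m (m + 3)) + y (vert m (m + 3)) + z (vert m (m + 1))) -
      (x (vert m (m + 1)) + y (vert m (m + 3)) + z (vert m (m + 3))) +
      (x (vert m (m + 1)) + y (vert m (m + 2)) + z (vert m m)) -
      (x (vert m m) + y (vert m (m + 2)) + z (vert m (m + 1))) +
      (x (vert m m) - z (vert m m) - (x (vert m 0) - z (vert m 0))) +
      (x (vert m 0) + y (vert m 0) + z (vert m (0 + 1))) -
      (x (vert m 0) + y (vert m 0) + z (vert m 0)) := by
    ring
  rw [key]
  push_cast
  rw [abs_le] at *
  constructor <;> linarith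

end TensorScaling

end

theorem mainTheorem2 :
    ∃ C K₁ K₂ c : ℝ, 0 < C ∧ 0 < K₁ ∧ 0 < K₂ ∧ 0 < c ∧
      ∀ n : ℕ, 3 ≤ n → ∀ ε : ℝ, 0 < ε →
        ε ≤ Real.exp (-(C * (n : ℝ) ^ 2 * Real.log (n : ℝ))) →
        ∃ v : TensorScaling.Tensor n,
          (TensorScaling.numNonzero v : ℝ) ≤ K₁ * (n : ℝ) ∧
          (∀ x, v x ≠ 0 → ∃ q : ℚ, v x = (q : ℂ) ∧
            (TensorScaling.bitComplexity q : ℝ) ≤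
              K₂ * (Real.log (n : ℝ) + Real.log (1 / ε))) ∧
          1 / 4 ≤ TensorScaling.capa v ∧ TensorScaling.capa v ≤ 1 ∧
          1 / 2 ≤ ‖v‖ ∧ ‖v‖ ≤ 1 ∧
          ∃ R : ℝ, c * ((2 : ℝ) ^ ((n : ℝ) / 3) * Real.log (1 / ε)) ≤ R ∧
            TensorScaling.capa v + ε ≤
              ⨅ g : TensorScaling.geodesicBall n R, ‖TensorScaling.act g.val v‖ ^ 2 := by
  refine ⟨100, 4, 1, 1 / 2000, by norm_num, by norm_num, by norm_num, by norm_num,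
    fun n hn ε hε hle => ?_⟩
  have hlog : 1 ≤ Real.log n := by
    have h3 : (3 : ℝ) ≤ n := by exact_mod_cast hn
    rw [Real.le_log_iff_exp_le (by linarith)]
    linarith [Real.exp_one_lt_d9]
  have hL : 100 * (n : ℝ) ^ 2 ≤ Real.log (1 / ε) := by
    have h1 := (Real.log_le_iff_le_exp hε).mpr hle
    rw [one_div, Real.log_inv]
    nlinarith [sq_nonneg (n : ℝ)]
  rcases Nat.lt_or_ge n 8 with h | h
  · exact (TensorScaling.diagonalDesign n hn).exists_tensor hn one_pos (by norm_num)
      (TensorScaling.diagonalDesign_isNearSpan hn (by omega)) hε hL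
  · obtain ⟨m, rfl⟩ := Nat.exists_eq_add_of_le' (show 4 ≤ n by omega)
    exact (TensorScaling.chainDesign m (by omega)).exists_tensor hn three_pos le_rfl
      (TensorScaling.chainDesign_isNearSpan (by omega)) hε hL
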